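/- Let $d\ge 1$, let $\Omega\subset\mathbb R^d$ be compact, with interior a bounded Lipschitz domain, and strictly star shaped with respect to $0$ (i.e. $\lambda x\in\operatorname{int}\Omega$ for all $x\in\Omega$, $0\le\lambda<1$). Let $1<\alpha<\frac{d}{d-1}$ ($1<\alpha<\infty$ if $d=1$), $\frac1\alpha+\frac1{\alpha'}=1$, let $w:\Omega\to[0,\infty)$ be continuous, let $\mu^+,\mu^-$ be Borel probability measures on $\Omega$, and $\mu=\mu^+-\mu^-$. Let $s\ge 0$ and $\Omega_\epsilon=(1+s)\Omega$; extend $\mu$ to $\Omega_\epsilon$ by zero and let $\hat w:\Omega_\epsilon\to\mathbb R$ be a continuous extension of $w$ with $\min_{\Omega_\epsilon}\hat w=\min_\Omega w$. For $q\in L^\alpha(\Omega_\epsilon;\mathbb R^d)$ the constraint $\operatorname{div}q=\mu$ means $$-\int_{\Omega_\epsilon}q\cdot\nabla\phi\,dx=\int_{\Omega_\epsilon}\phi\,d\mu\qquad\text{for all }\phi\in W^{1,\alpha'}(\operatorname{int}\Omega_\epsilon),$$ where $\phi$ on the right is the continuous representative on $\Omega_\epsilon$. For $\epsilon,\delta>0$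 let, for $x\in\Omega_\epsilon$ and $p\in\mathbb R^d$, $$\mathcal G_{\epsilon,\delta}(x,p)=\frac{\epsilon}{\alpha'}\Big(\frac1\epsilon\max\{|p|-\hat w(x),0\}\Big)^{\alpha'}+\delta\max\{|p|,\hat w(x)\}+\frac\delta2\min\Big\{\frac{|p|^2}{\hat w(x)},\hat w(x)\Big\}$$ (the last minimum being $0$ if $\hat w(x)=0$), and let $\mathcal G^*_{\epsilon,\delta}(x,q)=\sup_{p\in\mathbb R^d}\big(q\cdot p-\mathcal G_{\epsilon,\delta}(x,p)\big)$. Consider the problems $$(\mathrm{BP}_{\epsilon,\delta})\quad \min\Big\{\int_{\Omega_\epsilon}\mathcal G^*_{\epsilon,\delta}(x,q(x))\,dx \;:\; q\in L^\alpha(\Omega_\epsilon;\mathbb R^d),\ \operatorname{div}q=\mu\Big\},$$ $$(\mathrm{BP}_{\epsilon})\quad \min\Big\{\int_{\Omega_\epsilon}\hat w\,|q|\,dx+\frac\epsilon\alpha\|q\|_{L^\alpha(\Omega_\epsilon)}^\alpha \;:\; q\in L^\alpha(\Omega_\epsilon;\mathbb R^d),\ \operatorname{div}q=\mu\Big\}.$$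 Fix $\epsilon>0$, let $\delta_n>0$ with $\delta_n\to0$, and for each $n$ let $q_n$ be a solution of $(\mathrm{BP}_{\epsilon,\delta_n})$. Then $(q_n)$, regarded as a sequence of $\mathbb R^d$-valued Radon measures on $\Omega_\epsilon$ with the Lebesgue densities $q_n$, has a subsequence that converges weak-* in the space $C(\Omega_\epsilon;\mathbb R^d)^*$ of such measures to (the measure with density) a solution $q$ of $(\mathrm{BP}_\epsilon)$, and $q$ is the unique solution of $(\mathrm{BP}_\epsilon)$ up to equality almost everywhere. -/

import Mathlib

open MeasureTheory Filter Topology Set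
open scoped Pointwise ContDiff

noncomputable section

/-- Euclidean space `ℝ^d`. -/
abbrev Vec (d : ℕ) : Type := EuclideanSpace ℝ (Fin d)

/-- The open box `{z | |z_j| < a_j}` in the coordinates `b` centred at `c`. -/
def coordBox {d : ℕ} (b : OrthonormalBasis (Fin d) ℝ (Vec d)) (c : Vec d) (a : Fin d → ℝ) :
    Set (Vec d) :=
  {y | ∀ j, |b.repr (y - c) j| < a j}

/-- Bounded Lipschitz domain: a bounded, connected, nonempty open set such that near every boundary
point, in suitable orthogonal coordinates `y = (y', y_i)`, the set is the region strictly
below the graph of a Lipschitz function `g` of the remaining coordinates `y'`, and the boundary is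
that graph. -/
def IsBoundedLipschitzDomain {d : ℕ} (U : Set (Vec d)) : Prop :=
  IsOpen U ∧ IsConnected U ∧ Bornology.IsBounded U ∧
  ∀ x ∈ frontier U, ∃ (b : OrthonormalBasis (Fin d) ℝ (Vec d)) (c : Vec d) (i : Fin d)
    (a : Fin d → ℝ) (K : NNReal) (g : ({j : Fin d // j ≠ i} → ℝ) → ℝ),
    (∀ j, 0 < a j) ∧ x ∈ coordBox b c a ∧
    LipschitzOnWith K g {z | ∀ j, |z j| < a j} ∧
    (∀ z : {j : Fin d // j ≠ i} → ℝ, (∀ j, |z j| < a j) → |g z| ≤ a i / 2) ∧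
    ∀ y ∈ coordBox b c a,
      (y ∈ U ↔ b.repr (y - c) i < g (fun j => b.repr (y - c) j)) ∧
      (y ∈ frontier U ↔ b.repr (y - c) i = g (fun j => b.repr (y - c) j))

/-- `Ω` is strictly star shaped with respect to `0`. -/
def IsStrictlyStarShaped {d : ℕ} (Ω : Set (Vec d)) : Prop :=
  ∀ x ∈ Ω, ∀ t : ℝ, 0 ≤ t → t < 1 → t • x ∈ interior Ω

/-- `g` is a weak gradient of `φ` on the open set `U`. -/
def IsWeakGradient {d : ℕ} (U : Set (Vec d)) (φ : Vec d → ℝ) (g : Vec d → Vec d) : Prop :=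
  ∀ η : Vec d → ℝ, ContDiff ℝ ∞ η → HasCompactSupport η → tsupport η ⊆ U →
    ∀ v : Vec d, ∫ x in U, φ x * fderiv ℝ η x v = - ∫ x in U, inner ℝ (g x) v * η x

/-- `φ` belongs to the Sobolev space `W^{1,p}(U)`, with weak gradient `g`. -/
def IsSobolevWithGrad {d : ℕ} (U : Set (Vec d)) (p : ℝ) (φ : Vec d → ℝ) (g : Vec d → Vec d) :
    Prop :=
  MemLp φ (ENNReal.ofReal p) (volume.restrict U) ∧
  MemLp g (ENNReal.ofReal p) (volume.restrict U) ∧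
  IsWeakGradient U φ g

/-- The constraint `div q = μp - μm`: `-∫_E q · ∇φ = ∫_E φ dμp - ∫_E φ dμm` for every
`φ ∈ W^{1,p}(interior E)`. In the range where it is used, `W^{1,p}` embeds into `C(E)`; the measures
are paired with the continuous representative on the closed set `E`, so the test functions are taken
to be such representatives. -/
def HasDivergence {d : ℕ} (E : Set (Vec d)) (p : ℝ) (μp μm : Measure (Vec d))
    (q : Vec d → Vec d) : Prop :=
  ∀ (φ : Vec d → ℝ) (g : Vec d → Vec d), ContinuousOn φ E →
    IsSobolevWithGrad (interior E) p φ g →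
    - ∫ x in interior E, inner ℝ (q x) (g x) = (∫ x in E, φ x ∂μp) - ∫ x in E, φ x ∂μm

/-- `ℱ(p) = (ε / α') ((1 / ε) max (|p| - w, 0))^{α'}`, where `w` is the value of the cost at the
point considered. -/
def calF {d : ℕ} (α' ε w : ℝ) (p : Vec d) : ℝ :=
  ε / α' * (1 / ε * max (‖p‖ - w) 0) ^ α'

/-- The Huber term `ℛ(p) = δ max (|p|, w) + (δ / 2) min (|p|² / w, w)`. For `w = 0` the last minimum
is `0`. -/
def calR {d : ℕ} (δ w : ℝ) (p : Vec d) : ℝ :=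
  δ * max ‖p‖ w + δ / 2 * min (‖p‖ ^ 2 / w) w

/-- `𝒢 = ℱ + ℛ`. -/
def calG {d : ℕ} (α' ε δ w : ℝ) (p : Vec d) : ℝ :=
  calF α' ε w p + calR δ w p

/-- The Fenchel conjugate `𝒢*(s) = sup_p (s · p - 𝒢(p))`. The supremum is finite for `ε > 0`,
`α' > 1` since `𝒢` then grows superlinearly. -/
def calGConj {d : ℕ} (α' ε δ w : ℝ) (s : Vec d) : ℝ :=
  ⨆ p : Vec d, (inner ℝ s p - calG α' ε δ w p)

/-- The feasible flows: `q ∈ L^α(E; ℝ^d)` with `div q = μp - μm`. -/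
def feasibleFlows {d : ℕ} (E : Set (Vec d)) (α α' : ℝ) (μp μm : Measure (Vec d)) :
    Set (Vec d → Vec d) :=
  {q | MemLp q (ENNReal.ofReal α) (volume.restrict E) ∧ HasDivergence E α' μp μm q}

/-- The objective `∫_E w |q| dx + (ε / α) ‖q‖_{L^α(E)}^α` of the regularized Beckmann problem. -/
def regObjective {d : ℕ} (E : Set (Vec d)) (α ε : ℝ) (w : Vec d → ℝ) (q : Vec d → Vec d) : ℝ :=
  (∫ x in E, w x * ‖q x‖) + ε / α * ∫ x in E, ‖q x‖ ^ α

/-- The objective `∫_E 𝒢*(x, q(x)) dx` of the doubly regularized Beckmann problem. -/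
def huberObjective {d : ℕ} (E : Set (Vec d)) (α' ε δ : ℝ) (w : Vec d → ℝ) (q : Vec d → Vec d) :
    ℝ :=
  ∫ x in E, calGConj α' ε δ (w x) (q x)

/-- `q` solves the problem `(BP_ε)` on `E`. -/
def SolvesBP {d : ℕ} (E : Set (Vec d)) (α α' ε : ℝ) (w : Vec d → ℝ) (μp μm : Measure (Vec d))
    (q : Vec d → Vec d) : Prop :=
  q ∈ feasibleFlows E α α' μp μm ∧ IsMinOn (regObjective E α ε w) (feasibleFlows E α α' μp μm) q

/-- `q` solves the problem `(BP_{ε,δ})` on `E`. -/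
def SolvesHuberBP {d : ℕ} (E : Set (Vec d)) (α α' ε δ : ℝ) (w : Vec d → ℝ)
    (μp μm : Measure (Vec d)) (q : Vec d → Vec d) : Prop :=
  q ∈ feasibleFlows E α α' μp μm ∧
    IsMinOn (huberObjective E α' ε δ w) (feasibleFlows E α α' μp μm) q

/-- Weak-* convergence in the space `C(E; ℝ^d)^*` of `ℝ^d`-valued Radon measures on the compact set
`E`, of the measures with Lebesgue densities `q n` to the measure with density `q₀`. -/
def WeakStarTendsto {d : ℕ} (E : Set (Vec d)) (q : ℕ → Vec d → Vec d) (q₀ : Vec d → Vec d) :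
    Prop :=
  ∀ ψ : Vec d → Vec d, ContinuousOn ψ E →
    Tendsto (fun n => ∫ x in E, inner ℝ (ψ x) (q n x)) atTop (𝓝 (∫ x in E, inner ℝ (ψ x) (q₀ x)))

end

/-! The conjugate of `calF` is `s ↦ w‖s‖ + (ε/α)‖s‖^α`, the integrand of `regObjective`. Adding the
Huber term, which is nonnegative and of size `δ`, lowers the conjugate by at most `δ (3/2 w + ε +
ε‖s‖^α)` (`calGConj_le`, `le_calGConj`). Integrating this sandwich, and absorbing the `L^α` error
into the objective itself, shows that the `q n` form a minimizing sequence of the singly regularized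
problem (`tendsto_regObjective_of_solvesHuberBP`).

That problem is uniformly convex because of its `L^α` term: a pointwise inequality bounds `‖a -
b‖^α` by the midpoint convexity gap plus a small multiple of `‖a‖^α + ‖b‖^α`
(`exists_norm_sub_rpow_le`). Hence minimizing sequences are Cauchy in `L^α`, their limit is feasible
and optimal, and two solutions agree almost everywhere. The convergence is strong and concerns the
whole sequence; weak-* convergence follows by Hölder's inequality. -/

/-! ### Uniform convexity of powers of the norm. -/

/-- Strict midpoint convexity of `‖·‖ ^ α` in a strictly convex space. -/
theorem norm_midpoint_rpow_lt {V : Type*} [NormedAddCommGroup V] [NormedSpace ℝ V]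
    [StrictConvexSpace ℝ V] {α : ℝ} (hα : 1 < α) {a b : V} (hab : a ≠ b) :
    ‖(1 / 2 : ℝ) • (a + b)‖ ^ α < (‖a‖ ^ α + ‖b‖ ^ α) / 2 := by
  have hα0 : 0 < α := by linarith
  have hn : ‖(1 / 2 : ℝ) • (a + b)‖ = ‖a + b‖ / 2 := by
    rw [norm_smul]; norm_num; ring
  have hle : ‖a + b‖ ≤ ‖a‖ + ‖b‖ := norm_add_le a b
  rw [hn]
  -- For equal norms strictness comes from the strict convexity of the space, otherwise from that of
  -- `t ↦ t ^ α`.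
  by_cases h : ‖a‖ = ‖b‖
  · have hlt : ‖a + b‖ < ‖a‖ + ‖b‖ := by
      refine norm_add_lt_of_not_sameRay fun hs => hab ?_
      exact hs.eq_of_norm_eq h
    have : (‖a + b‖ / 2) ^ α < ‖a‖ ^ α :=
      Real.rpow_lt_rpow (by positivity) (by linarith) hα0
    rw [← h]; linarith
  · have h1 := (strictConvexOn_rpow hα).2 (mem_Ici.2 (norm_nonneg a)) (mem_Ici.2 (norm_nonneg b)) h
      (by norm_num : (0 : ℝ) < 1 / 2) (by norm_num : (0 : ℝ) < 1 / 2) (by norm_num)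
    simp only [smul_eq_mul] at h1
    have h2 : (‖a + b‖ / 2) ^ α ≤ (1 / 2 * ‖a‖ + 1 / 2 * ‖b‖) ^ α :=
      Real.rpow_le_rpow (by positivity) (by linarith) hα0.le
    linarith

theorem norm_midpoint_rpow_le {V : Type*} [NormedAddCommGroup V] [NormedSpace ℝ V]
    [StrictConvexSpace ℝ V] {α : ℝ} (hα : 1 < α) (a b : V) :
    ‖(1 / 2 : ℝ) • (a + b)‖ ^ α ≤ (‖a‖ ^ α + ‖b‖ ^ α) / 2 := by
  rcases eq_or_ne a b with rfl | h
  · rw [← two_smul ℝ a, smul_smul]; norm_num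
  · exact (norm_midpoint_rpow_lt hα h).le

/-- Uniform convexity of `‖·‖ ^ α` in a finite-dimensional strictly convex space: the distance of
two points is controlled by the midpoint convexity gap, up to an arbitrarily small multiple of
their size. -/
theorem exists_norm_sub_rpow_le {V : Type*} [NormedAddCommGroup V] [NormedSpace ℝ V]
    [StrictConvexSpace ℝ V] [FiniteDimensional ℝ V] {α : ℝ} (hα : 1 < α) {η : ℝ} (hη : 0 < η) :
    ∃ C : ℝ, 0 ≤ C ∧ ∀ a b : V, ‖a - b‖ ^ α ≤ η * (‖a‖ ^ α + ‖b‖ ^ α) +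
      C * ((‖a‖ ^ α + ‖b‖ ^ α) / 2 - ‖(1 / 2 : ℝ) • (a + b)‖ ^ α) := by
  have hα0 : 0 < α := by linarith
  have : ProperSpace V := FiniteDimensional.proper ℝ V
  let G : V × V → ℝ := fun z => (‖z.1‖ ^ α + ‖z.2‖ ^ α) / 2 - ‖(1 / 2 : ℝ) • (z.1 + z.2)‖ ^ α
  have hpc : ∀ f : V × V → V, Continuous f → Continuous fun z => ‖f z‖ ^ α := fun f hf =>
    hf.norm.rpow_const fun _ => Or.inr hα0.le
  have hGc : Continuous G :=
    (((hpc _ continuous_fst).add (hpc _ continuous_snd)).div_const 2).sub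
      (hpc _ ((continuous_fst.add continuous_snd).const_smul _))
  -- Both sides of the claim are homogeneous of degree `α`, so it suffices to treat the unit sphere.
  -- There the pairs with `‖a - b‖ ^ α < η` are trivial, and on the compact rest `K` the gap `G` has
  -- a positive minimum.
  let K : Set (V × V) := {z | ‖z.1‖ ^ α + ‖z.2‖ ^ α = 1 ∧ η ≤ ‖z.1 - z.2‖ ^ α}
  have hKclosed : IsClosed K :=
    (isClosed_eq ((hpc _ continuous_fst).add (hpc _ continuous_snd)) continuous_const).inter
      (isClosed_le continuous_const (hpc _ (continuous_fst.sub continuous_snd)))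
  have hle1 : ∀ t : ℝ, 0 ≤ t → t ^ α ≤ 1 → t ≤ 1 := fun t ht h => by
    by_contra! hc
    exact absurd h (not_le.2 (Real.one_lt_rpow hc hα0))
  have hKc : IsCompact K := by
    refine Metric.isCompact_of_isClosed_isBounded hKclosed
      ((Metric.isBounded_closedBall (x := (0 : V × V)) (r := 1)).subset ?_)
    rintro ⟨a, b⟩ ⟨h, -⟩
    have ha : 0 ≤ ‖a‖ ^ α := by positivity
    have hb : 0 ≤ ‖b‖ ^ α := by positivity
    simp only at h
    rw [mem_closedBall_zero_iff, Prod.norm_def]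
    exact max_le (hle1 _ (norm_nonneg _) (by linarith)) (hle1 _ (norm_nonneg _) (by linarith))
  have hGpos : ∀ z ∈ K, 0 < G z := by
    rintro ⟨a, b⟩ ⟨-, h⟩
    have hab : a ≠ b := by
      rintro rfl
      simp only [sub_self, norm_zero, Real.zero_rpow hα0.ne'] at h
      linarith
    exact sub_pos.2 (norm_midpoint_rpow_lt hα hab)
  have hbound : ∀ z : V × V, ‖z.1‖ ^ α + ‖z.2‖ ^ α = 1 → ‖z.1 - z.2‖ ^ α ≤ 2 ^ α := by
    rintro ⟨a, b⟩ h
    have ha : 0 ≤ ‖a‖ ^ α := by positivity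
    have hb : 0 ≤ ‖b‖ ^ α := by positivity
    simp only at h
    have h1 := hle1 _ (norm_nonneg a) (by linarith)
    have h2 := hle1 _ (norm_nonneg b) (by linarith)
    exact Real.rpow_le_rpow (norm_nonneg _) ((norm_sub_le a b).trans (by linarith)) hα0.le
  obtain ⟨m, hm0, hm⟩ : ∃ m : ℝ, 0 < m ∧ ∀ z ∈ K, m ≤ G z := by
    -- `K` is empty if `V` is trivial or `η` is large; any positive `m` then serves.
    rcases K.eq_empty_or_nonempty with h | h
    · exact ⟨1, one_pos, by simp [h]⟩
    · obtain ⟨z, hz, hmin⟩ := hKc.exists_isMinOn h hGc.continuousOn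
      exact ⟨G z, hGpos z hz, fun y hy => hmin hy⟩
  refine ⟨2 ^ α / m, by positivity, fun a b => ?_⟩
  set T := ‖a‖ ^ α + ‖b‖ ^ α with hT
  have hT0 : 0 ≤ T := by positivity
  rcases hT0.eq_or_lt with h0 | hTpos
  · have ha : ‖a‖ ^ α = 0 := le_antisymm (by nlinarith [show 0 ≤ ‖b‖ ^ α by positivity]) (by positivity)
    have hb : ‖b‖ ^ α = 0 := le_antisymm (by nlinarith [show 0 ≤ ‖a‖ ^ α by positivity]) (by positivity)
    rw [Real.rpow_eq_zero (norm_nonneg _) hα0.ne', norm_eq_zero] at ha hb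
    simp [ha, hb, Real.zero_rpow hα0.ne', ← h0]
  -- rescale to `‖a‖ ^ α + ‖b‖ ^ α = 1`
  set r := T ^ (-α⁻¹) with hr
  have hr0 : 0 < r := Real.rpow_pos_of_pos hTpos _
  have hrα : r ^ α = T⁻¹ := by
    rw [hr, ← Real.rpow_mul hT0, neg_mul, inv_mul_cancel₀ hα0.ne', Real.rpow_neg_one]
  have hs : ∀ v : V, ‖r • v‖ ^ α = T⁻¹ * ‖v‖ ^ α := fun v => by
    rw [norm_smul, Real.mul_rpow (norm_nonneg _) (norm_nonneg _), Real.norm_of_nonneg hr0.le, hrα]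
  have hG : G (r • a, r • b) = T⁻¹ * (T / 2 - ‖(1 / 2 : ℝ) • (a + b)‖ ^ α) := by
    simp only [G]
    rw [← smul_add, smul_comm, hs, hs, hs, hT]; ring
  have hsum : ‖r • a‖ ^ α + ‖r • b‖ ^ α = 1 := by
    rw [hs, hs, ← mul_add, ← hT, inv_mul_cancel₀ hTpos.ne']
  have hgap : 0 ≤ T / 2 - ‖(1 / 2 : ℝ) • (a + b)‖ ^ α := sub_nonneg.2 (norm_midpoint_rpow_le hα a b)
  have hsub : ‖r • a - r • b‖ ^ α = T⁻¹ * ‖a - b‖ ^ α := by rw [← smul_sub, hs]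
  have hmul : ‖a - b‖ ^ α = T * ‖r • a - r • b‖ ^ α := by
    rw [hsub, mul_inv_cancel_left₀ hTpos.ne']
  by_cases h : η ≤ ‖r • a - r • b‖ ^ α
  · have h1 := hm (r • a, r • b) ⟨hsum, h⟩
    rw [hG] at h1
    have h2 := hbound (r • a, r • b) hsum
    simp only at h2
    have h3 : T * m ≤ T / 2 - ‖(1 / 2 : ℝ) • (a + b)‖ ^ α := by
      have := mul_le_mul_of_nonneg_left h1 hT0
      rwa [mul_inv_cancel_left₀ hTpos.ne'] at this
    calc ‖a - b‖ ^ α ≤ T * 2 ^ α := by rw [hmul]; gcongr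
      _ = 2 ^ α / m * (T * m) := by field_simp
      _ ≤ 2 ^ α / m * (T / 2 - ‖(1 / 2 : ℝ) • (a + b)‖ ^ α) := by gcongr
      _ ≤ _ := le_add_of_nonneg_left (by positivity)
  · push Not at h
    calc ‖a - b‖ ^ α ≤ T * η := by rw [hmul]; gcongr
      _ = η * T := mul_comm _ _
      _ ≤ _ := le_add_of_nonneg_right (by positivity)

/-! ### Two-sided bounds for the conjugate. -/

theorem calR_nonneg {d : ℕ} {δ w : ℝ} (hδ : 0 ≤ δ) (hw : 0 ≤ w) (p : Vec d) : 0 ≤ calR δ w p := by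
  unfold calR
  have : 0 ≤ min (‖p‖ ^ 2 / w) w := le_min (by positivity) hw
  positivity

theorem calR_le {d : ℕ} {δ w : ℝ} (hδ : 0 ≤ δ) (p : Vec d) :
    calR δ w p ≤ δ * max ‖p‖ w + δ / 2 * w := by
  unfold calR
  have : min (‖p‖ ^ 2 / w) w ≤ w := min_le_right _ _
  gcongr

/-- Fenchel-Young inequality for `𝒢`, with the conjugate of `ℱ` as a majorant. -/
theorem inner_sub_calG_le {d : ℕ} {α α' ε δ w : ℝ} (hα : α.HolderConjugate α') (hε : 0 < ε)
    (hδ : 0 ≤ δ) (hw : 0 ≤ w) (s p : Vec d) :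
    inner ℝ s p - calG α' ε δ w p ≤ w * ‖s‖ + ε / α * ‖s‖ ^ α := by
  have hR := calR_nonneg hδ hw p
  have hi : inner ℝ s p ≤ ‖s‖ * ‖p‖ := real_inner_le_norm s p
  set t := max (‖p‖ - w) 0 with ht
  have ht0 : 0 ≤ t := le_max_right _ _
  have hpt : ‖p‖ ≤ w + t := by linarith [le_max_left (‖p‖ - w) 0]
  -- Young's inequality for `‖s‖` and `t / ε`, multiplied by `ε`, produces exactly the power term of
  -- `calF`.
  have hy := Real.young_inequality_of_nonneg (norm_nonneg s)
    (show 0 ≤ 1 / ε * t by positivity) hα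
  have h1 : ‖s‖ * t ≤ ε * (‖s‖ ^ α / α + (1 / ε * t) ^ α' / α') := by
    calc ‖s‖ * t = ε * (‖s‖ * (1 / ε * t)) := by field_simp
      _ ≤ _ := by gcongr
  have h2 : ‖s‖ * ‖p‖ ≤ ‖s‖ * (w + t) := by gcongr
  have h3 : calG α' ε δ w p = ε / α' * (1 / ε * t) ^ α' + calR δ w p := rfl
  rw [h3]
  have h4 : ε * (‖s‖ ^ α / α + (1 / ε * t) ^ α' / α') =
    ε / α * ‖s‖ ^ α + ε / α' * (1 / ε * t) ^ α' := by ring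
  linarith

theorem bddAbove_inner_sub_calG {d : ℕ} {α α' ε δ w : ℝ} (hα : α.HolderConjugate α') (hε : 0 < ε)
    (hδ : 0 ≤ δ) (hw : 0 ≤ w) (s : Vec d) :
    BddAbove (range fun p : Vec d => inner ℝ s p - calG α' ε δ w p) :=
  ⟨_, forall_mem_range.2 fun p => inner_sub_calG_le hα hε hδ hw s p⟩

theorem calGConj_le {d : ℕ} {α α' ε δ w : ℝ} (hα : α.HolderConjugate α') (hε : 0 < ε)
    (hδ : 0 ≤ δ) (hw : 0 ≤ w) (s : Vec d) :
    calGConj α' ε δ w s ≤ w * ‖s‖ + ε / α * ‖s‖ ^ α :=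
  ciSup_le fun p => inner_sub_calG_le hα hε hδ hw s p

/-- The supremum is tested at a maximizer of `p ↦ s · p - calF p`, so the only loss is the value of
`calR` there. -/
theorem le_calGConj {d : ℕ} {α α' ε δ w : ℝ} (hα : α.HolderConjugate α') (hε : 0 < ε)
    (hδ : 0 ≤ δ) (hw : 0 ≤ w) (s : Vec d) :
    w * ‖s‖ + ε / α * ‖s‖ ^ α - δ * (3 / 2 * w + ε + ε * ‖s‖ ^ α) ≤ calGConj α' ε δ w s := by
  have hα0 := hα.pos
  have hα0' := hα.symm.pos
  rcases eq_or_ne s 0 with rfl | hs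
  · refine le_trans ?_ (le_ciSup (bddAbove_inner_sub_calG hα hε hδ hw (0 : Vec d)) 0)
    have hR := calR_le (d := d) (w := w) hδ 0
    have hF : calF α' ε w (0 : Vec d) = 0 := by
      simp [calF, hw, Real.zero_rpow hα0'.ne']
    simp only [norm_zero, max_eq_right hw] at hR
    simp only [calG, hF, inner_zero_right, norm_zero, Real.zero_rpow hα0.ne']
    nlinarith [mul_nonneg hδ hε.le]
  have hsn : 0 < ‖s‖ := norm_pos_iff.2 hs
  set ρ := ‖s‖ ^ (α - 1) with hρ
  have hρ0 : 0 ≤ ρ := by positivity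
  have hρs : ‖s‖ * ρ = ‖s‖ ^ α := by
    rw [hρ, Real.rpow_sub_one hsn.ne']; field_simp
  have hρle : ρ ≤ 1 + ‖s‖ ^ α := by
    rcases le_total ‖s‖ 1 with h | h
    · have : ρ ≤ 1 := Real.rpow_le_one hsn.le h hα.sub_one_pos.le
      linarith [show 0 ≤ ‖s‖ ^ α by positivity]
    · have : ρ ≤ ‖s‖ ^ α := Real.rpow_le_rpow_of_exponent_le h (by linarith)
      linarith
  -- The vector parallel to `s` for which Young's inequality is an equality: `(‖p‖ - w) / ε = ‖s‖ ^
  -- (α - 1)`.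
  set p : Vec d := ((w + ε * ρ) / ‖s‖) • s with hp
  have hpn : ‖p‖ = w + ε * ρ := by
    rw [hp, norm_smul, Real.norm_of_nonneg (by positivity)]; field_simp
  have hpi : inner ℝ s p = ‖s‖ * (w + ε * ρ) := by
    rw [hp, real_inner_smul_right, real_inner_self_eq_norm_sq]; field_simp
  have hF : calF α' ε w p = ε / α' * ‖s‖ ^ α := by
    have h1 : max (‖p‖ - w) 0 = ε * ρ := by
      rw [hpn, add_sub_cancel_left, max_eq_left (by positivity)]
    have h2 : 1 / ε * (ε * ρ) = ρ := by field_simp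
    rw [calF, h1, h2, hρ, ← Real.rpow_mul hsn.le, hα.sub_one_mul_conj]
  have hR := calR_le (w := w) hδ p
  rw [hpn, max_eq_left (by nlinarith)] at hR
  refine le_trans ?_ (le_ciSup (bddAbove_inner_sub_calG hα hε hδ hw s) p)
  simp only [calG, hF, hpi]
  have hinv : ε / α + ε / α' = ε := by
    have := hα.inv_add_inv_eq_one
    calc ε / α + ε / α' = ε * (α⁻¹ + α'⁻¹) := by ring
      _ = ε := by rw [this, mul_one]
  have h5 : ε * ‖s‖ ^ α = ε / α * ‖s‖ ^ α + ε / α' * ‖s‖ ^ α := by rw [← add_mul, hinv]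
  have h6 : ‖s‖ * (w + ε * ρ) = w * ‖s‖ + ε * ‖s‖ ^ α := by rw [← hρs]; ring
  have h7 : δ * (ε * ρ) ≤ δ * (ε * (1 + ‖s‖ ^ α)) := by gcongr
  rw [h6]
  nlinarith

/-! ### Measurability of the conjugate integrand. -/

theorem continuous_calG {d : ℕ} {α' ε δ : ℝ} (hα' : 0 < α') (w : ℝ) :
    Continuous fun p : Vec d => calG α' ε δ w p := by
  unfold calG calF calR
  refine ((Continuous.rpow_const (by fun_prop) fun _ => Or.inr hα'.le).const_mul _).add ?_
  exact (by fun_prop : Continuous fun p : Vec d => δ * max ‖p‖ w).add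
    (((((continuous_norm.pow 2).div_const w)).min continuous_const).const_mul _)

theorem measurable_calG {d : ℕ} (α' ε δ : ℝ) (p : Vec d) :
    Measurable fun w : ℝ => calG α' ε δ w p := by
  unfold calG calF calR
  fun_prop

/-- Continuity in `p` reduces the supremum to a countable one, for which measurability is available.
-/
theorem calGConj_eq_iSup_denseSeq {d : ℕ} {α α' ε δ w : ℝ} (hα : α.HolderConjugate α')
    (hε : 0 < ε) (hδ : 0 ≤ δ) (hw : 0 ≤ w) (s : Vec d) :
    calGConj α' ε δ w s = ⨆ n : ℕ, (inner ℝ s (TopologicalSpace.denseSeq (Vec d) n) -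
      calG α' ε δ w (TopologicalSpace.denseSeq (Vec d) n)) := by
  have hc : Continuous fun p : Vec d => inner ℝ s p - calG α' ε δ w p :=
    (by fun_prop : Continuous fun p : Vec d => inner ℝ s p).sub (continuous_calG hα.symm.pos w)
  have hb := bddAbove_inner_sub_calG hα hε hδ hw s
  have hb' : BddAbove (range fun n : ℕ => (inner ℝ s (TopologicalSpace.denseSeq (Vec d) n) -
      calG α' ε δ w (TopologicalSpace.denseSeq (Vec d) n))) :=
    hb.mono (range_comp_subset_range (TopologicalSpace.denseSeq (Vec d))
      fun p : Vec d => inner ℝ s p - calG α' ε δ w p)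
  refine le_antisymm (ciSup_le fun p => ?_) (ciSup_le fun n => le_ciSup hb _)
  have hcl : IsClosed {p : Vec d | inner ℝ s p - calG α' ε δ w p ≤
      ⨆ n : ℕ, (inner ℝ s (TopologicalSpace.denseSeq (Vec d) n) -
        calG α' ε δ w (TopologicalSpace.denseSeq (Vec d) n))} :=
    isClosed_le hc continuous_const
  exact (TopologicalSpace.denseRange_denseSeq (Vec d)).induction_on p hcl fun n => le_ciSup hb' n

/-- Together with the two-sided bounds this yields integrability, without which the Bochner integral
in `huberObjective` would default to `0`. -/
theorem aestronglyMeasurable_calGConj {X : Type*} [MeasurableSpace X] {ν : Measure X} {d : ℕ}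
    {α α' ε δ : ℝ} (hα : α.HolderConjugate α') (hε : 0 < ε) (hδ : 0 ≤ δ) {w : X → ℝ}
    (hw : AEMeasurable w ν) (hw0 : ∀ᵐ x ∂ν, 0 ≤ w x) {q : X → Vec d} (hq : AEMeasurable q ν) :
    AEStronglyMeasurable (fun x => calGConj α' ε δ (w x) (q x)) ν := by
  have : AEMeasurable (fun x => ⨆ n : ℕ, (inner ℝ (q x) (TopologicalSpace.denseSeq (Vec d) n) -
      calG α' ε δ (w x) (TopologicalSpace.denseSeq (Vec d) n))) ν :=
    AEMeasurable.iSup fun n => (hq.inner aemeasurable_const).sub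
      ((measurable_calG α' ε δ _).comp_aemeasurable hw)
  refine this.aestronglyMeasurable.congr ?_
  filter_upwards [hw0] with x hx
  exact (calGConj_eq_iSup_denseSeq hα hε hδ hx _).symm

/-! ### Convergence in `L^α` expressed through integrals. -/

section LpConvergence

variable {X V : Type*} [MeasurableSpace X] {ν : Measure X} [NormedAddCommGroup V]
  {α α' : ℝ}

theorem MeasureTheory.MemLp.integrable_norm_rpow_ofReal {f : X → V} (hα : 0 < α)
    (hf : MemLp f (ENNReal.ofReal α) ν) : Integrable (fun x => ‖f x‖ ^ α) ν := by
  have := hf.integrable_norm_rpow (by simpa using hα) ENNReal.ofReal_ne_top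
  rwa [ENNReal.toReal_ofReal hα.le] at this

theorem MeasureTheory.MemLp.norm_toLp_rpow {f : X → V} (hα : 0 < α)
    (hf : MemLp f (ENNReal.ofReal α) ν) : ‖hf.toLp f‖ ^ α = ∫ x, ‖f x‖ ^ α ∂ν := by
  have h0 : 0 ≤ ∫ x, ‖f x‖ ^ α ∂ν := integral_nonneg fun x => by positivity
  rw [Lp.norm_toLp, hf.eLpNorm_eq_integral_rpow_norm (by simpa using hα) ENNReal.ofReal_ne_top,
    ENNReal.toReal_ofReal hα.le, ENNReal.toReal_ofReal (by positivity), ← Real.rpow_mul h0,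
    inv_mul_cancel₀ hα.ne', Real.rpow_one]

theorem integrable_norm_mul_norm {W : Type*} [NormedAddCommGroup W] {f : X → V} {g : X → W}
    (hα : α.HolderConjugate α') (hf : MemLp f (ENNReal.ofReal α) ν)
    (hg : MemLp g (ENNReal.ofReal α') ν) : Integrable (fun x => ‖f x‖ * ‖g x‖) ν := by
  have : ENNReal.HolderConjugate (ENNReal.ofReal α) (ENNReal.ofReal α') :=
    ENNReal.holderConjugate_iff.2 hα.inv_add_inv_ennreal
  exact hf.norm.integrable_mul hg.norm

theorem integrable_inner_of_memLp [InnerProductSpace ℝ V] {f g : X → V}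
    (hα : α.HolderConjugate α') (hf : MemLp f (ENNReal.ofReal α) ν)
    (hg : MemLp g (ENNReal.ofReal α') ν) : Integrable (fun x => inner ℝ (f x) (g x)) ν :=
  (integrable_norm_mul_norm hα hf hg).mono' (hf.1.inner hg.1)
    (ae_of_all _ fun _ => norm_inner_le_norm _ _)

/-- Convergence in `L^α` implies convergence of the integral weighted by an `L^α'` function. -/
theorem tendsto_integral_norm_sub_mul {W : Type*} [NormedAddCommGroup W] {f : ℕ → X → V}
    {f₀ : X → V} {g : X → W} (hα : α.HolderConjugate α')
    (hf : ∀ n, MemLp (f n) (ENNReal.ofReal α) ν) (hf₀ : MemLp f₀ (ENNReal.ofReal α) ν)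
    (hg : MemLp g (ENNReal.ofReal α') ν)
    (hlim : Tendsto (fun n => ∫ x, ‖f n x - f₀ x‖ ^ α ∂ν) atTop (𝓝 0)) :
    Tendsto (fun n => ∫ x, ‖f n x - f₀ x‖ * ‖g x‖ ∂ν) atTop (𝓝 0) := by
  have hb : Tendsto (fun n => (∫ x, ‖f n x - f₀ x‖ ^ α ∂ν) ^ (1 / α) *
      (∫ x, ‖g x‖ ^ α' ∂ν) ^ (1 / α')) atTop (𝓝 0) := by
    have := (hlim.rpow_const (p := 1 / α) (Or.inr hα.one_div_nonneg)).mul_const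
      ((∫ x, ‖g x‖ ^ α' ∂ν) ^ (1 / α'))
    rwa [Real.zero_rpow hα.one_div_ne_zero, zero_mul] at this
  refine squeeze_zero (fun n => integral_nonneg fun x => by positivity) (fun n => ?_) hb
  have := integral_mul_norm_le_Lp_mul_Lq hα (f := fun x => ‖f n x - f₀ x‖) (g := fun x => ‖g x‖)
    ((hf n).sub hf₀).norm hg.norm
  simpa only [norm_norm] using this

/-- Serves twice: with `g` a weak gradient it passes the divergence constraint to the limit, with
`g` continuous it gives weak-* convergence. -/
theorem tendsto_integral_inner [InnerProductSpace ℝ V] {f : ℕ → X → V}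
    {f₀ g : X → V} (hα : α.HolderConjugate α')
    (hf : ∀ n, MemLp (f n) (ENNReal.ofReal α) ν) (hf₀ : MemLp f₀ (ENNReal.ofReal α) ν)
    (hg : MemLp g (ENNReal.ofReal α') ν)
    (hlim : Tendsto (fun n => ∫ x, ‖f n x - f₀ x‖ ^ α ∂ν) atTop (𝓝 0)) :
    Tendsto (fun n => ∫ x, inner ℝ (f n x) (g x) ∂ν) atTop (𝓝 (∫ x, inner ℝ (f₀ x) (g x) ∂ν)) := by
  rw [tendsto_iff_norm_sub_tendsto_zero]
  refine squeeze_zero (fun n => norm_nonneg _) (fun n => ?_)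
    (tendsto_integral_norm_sub_mul hα hf hf₀ hg hlim)
  rw [← integral_sub (integrable_inner_of_memLp hα (hf n) hg)
    (integrable_inner_of_memLp hα hf₀ hg)]
  refine norm_integral_le_of_norm_le
    (integrable_norm_mul_norm hα ((hf n).sub hf₀) hg) (ae_of_all _ fun x => ?_)
  rw [← inner_sub_left]
  exact norm_inner_le_norm _ _

theorem tendsto_integral_mul_norm {f : ℕ → X → V} {f₀ : X → V} {w : X → ℝ}
    (hα : α.HolderConjugate α')
    (hf : ∀ n, MemLp (f n) (ENNReal.ofReal α) ν) (hf₀ : MemLp f₀ (ENNReal.ofReal α) ν)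
    (hw : MemLp w (ENNReal.ofReal α') ν)
    (hlim : Tendsto (fun n => ∫ x, ‖f n x - f₀ x‖ ^ α ∂ν) atTop (𝓝 0)) :
    Tendsto (fun n => ∫ x, w x * ‖f n x‖ ∂ν) atTop (𝓝 (∫ x, w x * ‖f₀ x‖ ∂ν)) := by
  have hint : ∀ f : X → V, MemLp f (ENNReal.ofReal α) ν → Integrable (fun x => w x * ‖f x‖) ν :=
    fun f hf => (integrable_norm_mul_norm hα hf hw).mono' (hw.1.mul hf.1.norm)
      (ae_of_all _ fun x => by rw [norm_mul, norm_norm, mul_comm])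
  rw [tendsto_iff_norm_sub_tendsto_zero]
  refine squeeze_zero (fun n => norm_nonneg _) (fun n => ?_)
    (tendsto_integral_norm_sub_mul hα hf hf₀ hw hlim)
  rw [← integral_sub (hint _ (hf n)) (hint _ hf₀)]
  refine norm_integral_le_of_norm_le
    (integrable_norm_mul_norm hα ((hf n).sub hf₀) hw) (ae_of_all _ fun x => ?_)
  rw [← mul_sub, norm_mul, mul_comm]
  gcongr
  exact abs_norm_sub_norm_le _ _

theorem tendsto_integral_norm_rpow {f : ℕ → X → V} {f₀ : X → V} (hα : 1 ≤ α)
    (hf : ∀ n, MemLp (f n) (ENNReal.ofReal α) ν) (hf₀ : MemLp f₀ (ENNReal.ofReal α) ν)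
    (hlim : Tendsto (fun n => ∫ x, ‖f n x - f₀ x‖ ^ α ∂ν) atTop (𝓝 0)) :
    Tendsto (fun n => ∫ x, ‖f n x‖ ^ α ∂ν) atTop (𝓝 (∫ x, ‖f₀ x‖ ^ α ∂ν)) := by
  have hα0 : 0 < α := by linarith
  have : Fact (1 ≤ ENNReal.ofReal α) := ⟨by simpa using hα⟩
  have h1 : Tendsto (fun n => (hf n).toLp (f n)) atTop (𝓝 (hf₀.toLp f₀)) := by
    rw [tendsto_iff_norm_sub_tendsto_zero]
    have h2 := hlim.rpow_const (p := α⁻¹) (Or.inr (by positivity))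
    rw [Real.zero_rpow (by positivity)] at h2
    refine h2.congr fun n => ?_
    rw [← MemLp.toLp_sub (hf n) hf₀]
    have h3 := ((hf n).sub hf₀).norm_toLp_rpow hα0
    simp only [Pi.sub_apply] at h3
    rw [← h3, ← Real.rpow_mul (norm_nonneg _), mul_inv_cancel₀ hα0.ne', Real.rpow_one]
  have h4 := h1.norm.rpow_const (p := α) (Or.inr hα0.le)
  rw [hf₀.norm_toLp_rpow hα0] at h4
  exact h4.congr fun n => (hf n).norm_toLp_rpow hα0

/-- Completeness of `L^α`, in terms of integrals. -/
theorem exists_memLp_tendsto_of_cauchy [CompleteSpace V] {f : ℕ → X → V} (hα : 1 ≤ α)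
    (hf : ∀ n, MemLp (f n) (ENNReal.ofReal α) ν)
    (hc : ∀ η > 0, ∃ N, ∀ n ≥ N, ∀ m ≥ N, ∫ x, ‖f n x - f m x‖ ^ α ∂ν < η) :
    ∃ f₀ : X → V, MemLp f₀ (ENNReal.ofReal α) ν ∧
      Tendsto (fun n => ∫ x, ‖f n x - f₀ x‖ ^ α ∂ν) atTop (𝓝 0) := by
  have hα0 : 0 < α := by linarith
  have : Fact (1 ≤ ENNReal.ofReal α) := ⟨by simpa using hα⟩
  have hcs : CauchySeq fun n => (hf n).toLp (f n) := by
    rw [Metric.cauchySeq_iff]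
    intro η hη
    obtain ⟨N, hN⟩ := hc (η ^ α) (by positivity)
    refine ⟨N, fun n hn m hm => ?_⟩
    have h3 := ((hf n).sub (hf m)).norm_toLp_rpow hα0
    rw [dist_eq_norm, ← MemLp.toLp_sub (hf n) (hf m)]
    refine (Real.rpow_lt_rpow_iff (norm_nonneg _) hη.le hα0).1 ?_
    rw [h3]
    exact hN n hn m hm
  obtain ⟨g, hg⟩ := cauchySeq_tendsto_of_complete hcs
  refine ⟨g, Lp.memLp g, ?_⟩
  have h4 := (tendsto_iff_norm_sub_tendsto_zero.1 hg).rpow_const (p := α) (Or.inr hα0.le)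
  rw [Real.zero_rpow hα0.ne'] at h4
  refine h4.congr fun n => ?_
  have h5 : (hf n).toLp (f n) - g = ((hf n).sub (Lp.memLp g)).toLp (f n - (g : X → V)) := by
    rw [MemLp.toLp_sub (hf n) (Lp.memLp g), Lp.toLp_coeFn]
  rw [h5, MemLp.norm_toLp_rpow hα0]
  rfl

end LpConvergence

theorem memLp_of_continuousOn {d : ℕ} {V : Type*} [NormedAddCommGroup V]
    [SecondCountableTopologyEither (Vec d) V] {E : Set (Vec d)}
    (hE : IsCompact E) {ψ : Vec d → V} (hψ : ContinuousOn ψ E) (p : ENNReal) :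
    MemLp ψ p (volume.restrict E) := by
  have : IsFiniteMeasure (volume.restrict E) := isFiniteMeasure_restrict.2 hE.measure_lt_top.ne
  obtain ⟨C, hC⟩ := hE.exists_bound_of_continuousOn hψ
  exact MemLp.of_bound (hψ.aestronglyMeasurable hE.measurableSet) C
    (ae_restrict_of_forall_mem hE.measurableSet hC)

/-! ### Convexity and closedness of the constraint, and minimization of the regularized objective.
-/

section Flows

variable {d : ℕ} {E : Set (Vec d)} {α α' ε : ℝ} {w : Vec d → ℝ} {μp μm : Measure (Vec d)}

theorem integrable_mul_norm_of_continuousOn (hE : IsCompact E) (hα : α.HolderConjugate α')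
    (hw : ContinuousOn w E) {q : Vec d → Vec d}
    (hq : MemLp q (ENNReal.ofReal α) (volume.restrict E)) :
    Integrable (fun x => w x * ‖q x‖) (volume.restrict E) := by
  have hwm := memLp_of_continuousOn hE hw (ENNReal.ofReal α')
  exact (integrable_norm_mul_norm hα hq hwm).mono' (hwm.1.mul hq.1.norm)
    (ae_of_all _ fun x => by rw [norm_mul, norm_norm, mul_comm])

theorem midpoint_mem_feasibleFlows (hα : α.HolderConjugate α') {a b : Vec d → Vec d}
    (ha : a ∈ feasibleFlows E α α' μp μm) (hb : b ∈ feasibleFlows E α α' μp μm) :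
    (fun x => (1 / 2 : ℝ) • (a x + b x)) ∈ feasibleFlows E α α' μp μm := by
  refine ⟨(ha.1.add hb.1).const_smul (1 / 2 : ℝ), fun φ g hφ hg => ?_⟩
  have h1 := ha.2 φ g hφ hg
  have h2 := hb.2 φ g hφ hg
  -- Flows are integrable over `E`, whereas the constraint integrates over its interior.
  have hr : volume.restrict (interior E) ≤ volume.restrict E :=
    Measure.restrict_mono interior_subset le_rfl
  have e : ∀ x, inner ℝ ((1 / 2 : ℝ) • (a x + b x)) (g x) =
      1 / 2 * (inner ℝ (a x) (g x) + inner ℝ (b x) (g x)) := fun x => by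
    rw [real_inner_smul_left, inner_add_left]
  simp only [e]
  rw [integral_const_mul, integral_add
    (integrable_inner_of_memLp hα (ha.1.mono_measure hr) hg.2.1)
    (integrable_inner_of_memLp hα (hb.1.mono_measure hr) hg.2.1)]
  linarith

/-- The set of feasible flows is closed in `L^α`. -/
theorem mem_feasibleFlows_of_tendsto (hα : α.HolderConjugate α') {f : ℕ → Vec d → Vec d}
    {f₀ : Vec d → Vec d} (hf : ∀ n, f n ∈ feasibleFlows E α α' μp μm)
    (hf₀ : MemLp f₀ (ENNReal.ofReal α) (volume.restrict E))
    (hlim : Tendsto (fun n => ∫ x in E, ‖f n x - f₀ x‖ ^ α) atTop (𝓝 0)) :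
    f₀ ∈ feasibleFlows E α α' μp μm := by
  refine ⟨hf₀, fun φ g hφ hg => ?_⟩
  have hr : volume.restrict (interior E) ≤ volume.restrict E :=
    Measure.restrict_mono interior_subset le_rfl
  have hlim' : Tendsto (fun n => ∫ x in interior E, ‖f n x - f₀ x‖ ^ α) atTop (𝓝 0) :=
    squeeze_zero (fun n => integral_nonneg fun x => by positivity)
      (fun n => setIntegral_mono_set (((hf n).1.sub hf₀).integrable_norm_rpow_ofReal hα.pos)
        (ae_of_all _ fun x => by positivity) interior_subset.eventuallyLE) hlim
  have := (tendsto_integral_inner hα (fun n => (hf n).1.mono_measure hr) (hf₀.mono_measure hr)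
    hg.2.1 hlim').neg
  exact tendsto_nhds_unique (this.congr fun n => (hf n).2 φ g hφ hg) tendsto_const_nhds

theorem regObjective_eq_integral (hE : IsCompact E) (hα : α.HolderConjugate α')
    (hw : ContinuousOn w E) {q : Vec d → Vec d}
    (hq : MemLp q (ENNReal.ofReal α) (volume.restrict E)) :
    regObjective E α ε w q = ∫ x in E, (w x * ‖q x‖ + ε / α * ‖q x‖ ^ α) := by
  rw [integral_add (integrable_mul_norm_of_continuousOn hE hα hw hq)
    ((hq.integrable_norm_rpow_ofReal hα.pos).const_mul _), integral_const_mul]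
  rfl

theorem integrable_regObjective (hE : IsCompact E) (hα : α.HolderConjugate α')
    (hw : ContinuousOn w E) {q : Vec d → Vec d}
    (hq : MemLp q (ENNReal.ofReal α) (volume.restrict E)) :
    Integrable (fun x => w x * ‖q x‖ + ε / α * ‖q x‖ ^ α) (volume.restrict E) :=
  (integrable_mul_norm_of_continuousOn hE hα hw hq).add
    ((hq.integrable_norm_rpow_ofReal hα.pos).const_mul _)

/-- Coercivity: the weighted term is nonnegative. It also gives nonnegativity of the objective. -/
theorem rpow_integral_le_regObjective (hE : IsCompact E) (hw0 : ∀ x ∈ E, 0 ≤ w x)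
    (q : Vec d → Vec d) : ε / α * ∫ x in E, ‖q x‖ ^ α ≤ regObjective E α ε w q :=
  le_add_of_nonneg_left (setIntegral_nonneg hE.measurableSet fun x hx =>
    mul_nonneg (hw0 x hx) (norm_nonneg _))

theorem tendsto_regObjective (hE : IsCompact E) (hα : α.HolderConjugate α')
    (hw : ContinuousOn w E) {f : ℕ → Vec d → Vec d} {f₀ : Vec d → Vec d}
    (hf : ∀ n, MemLp (f n) (ENNReal.ofReal α) (volume.restrict E))
    (hf₀ : MemLp f₀ (ENNReal.ofReal α) (volume.restrict E))
    (hlim : Tendsto (fun n => ∫ x in E, ‖f n x - f₀ x‖ ^ α) atTop (𝓝 0)) :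
    Tendsto (fun n => regObjective E α ε w (f n)) atTop (𝓝 (regObjective E α ε w f₀)) :=
  (tendsto_integral_mul_norm hα hf hf₀ (memLp_of_continuousOn hE hw _) hlim).add
    ((tendsto_integral_norm_rpow hα.lt.le hf hf₀ hlim).const_mul _)

/-- The midpoint convexity gap of the regularized objective controls that of the `L^α` norm. -/
theorem integral_midpoint_gap_le (hE : IsCompact E) (hα : α.HolderConjugate α')
    (hw : ContinuousOn w E) (hw0 : ∀ x ∈ E, 0 ≤ w x) {a b : Vec d → Vec d}
    (ha : MemLp a (ENNReal.ofReal α) (volume.restrict E))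
    (hb : MemLp b (ENNReal.ofReal α) (volume.restrict E)) :
    ε / α * ∫ x in E, ((‖a x‖ ^ α + ‖b x‖ ^ α) / 2 - ‖(1 / 2 : ℝ) • (a x + b x)‖ ^ α) ≤
      (regObjective E α ε w a + regObjective E α ε w b) / 2 -
        regObjective E α ε w (fun x => (1 / 2 : ℝ) • (a x + b x)) := by
  have hm : MemLp (fun x => (1 / 2 : ℝ) • (a x + b x)) (ENNReal.ofReal α) (volume.restrict E) :=
    (ha.add hb).const_smul (1 / 2 : ℝ)
  have hia := ha.integrable_norm_rpow_ofReal hα.pos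
  have hib := hb.integrable_norm_rpow_ofReal hα.pos
  have him := hm.integrable_norm_rpow_ofReal hα.pos
  have hra := integrable_regObjective (ε := ε) hE hα hw ha
  have hrb := integrable_regObjective (ε := ε) hE hα hw hb
  have hrm := integrable_regObjective (ε := ε) hE hα hw hm
  have hrab : Integrable (fun x => (w x * ‖a x‖ + ε / α * ‖a x‖ ^ α +
      (w x * ‖b x‖ + ε / α * ‖b x‖ ^ α)) / 2) (volume.restrict E) := (hra.add hrb).div_const 2
  rw [regObjective_eq_integral hE hα hw ha, regObjective_eq_integral hE hα hw hb,
    regObjective_eq_integral hE hα hw hm, ← integral_add hra hrb, ← integral_div,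
    ← integral_sub hrab hrm, ← integral_const_mul]
  refine setIntegral_mono_on ((((hia.add hib).div_const 2).sub him).const_mul _)
    (hrab.sub hrm) hE.measurableSet fun x hx => ?_
  -- The weighted norm is convex since `w ≥ 0`, so its share of the gap is nonnegative and can be
  -- dropped.
  have h1 : ‖(1 / 2 : ℝ) • (a x + b x)‖ ≤ (‖a x‖ + ‖b x‖) / 2 := by
    rw [norm_smul, Real.norm_of_nonneg (by norm_num)]
    linarith [norm_add_le (a x) (b x)]
  have h2 := mul_le_mul_of_nonneg_left h1 (hw0 x hx)
  linarith

/-- Two feasible flows that nearly minimize the regularized objective are close in `L^α`. -/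
theorem exists_integral_norm_sub_rpow_le (hE : IsCompact E) (hα : α.HolderConjugate α')
    (hε : 0 < ε) (hw : ContinuousOn w E) (hw0 : ∀ x ∈ E, 0 ≤ w x) {I : ℝ}
    (hI : ∀ p ∈ feasibleFlows E α α' μp μm, I ≤ regObjective E α ε w p) {η : ℝ} (hη : 0 < η) :
    ∃ C : ℝ, 0 ≤ C ∧ ∀ a ∈ feasibleFlows E α α' μp μm, ∀ b ∈ feasibleFlows E α α' μp μm,
      ∫ x in E, ‖a x - b x‖ ^ α ≤ η * (regObjective E α ε w a + regObjective E α ε w b) +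
        C * ((regObjective E α ε w a + regObjective E α ε w b) / 2 - I) := by
  have hα0 := hα.pos
  -- The factor `ε / α` lets coercivity turn the small term into `η` times the sum of the
  -- objectives.
  obtain ⟨C, hC0, hC⟩ := exists_norm_sub_rpow_le (V := Vec d) hα.lt
    (show 0 < η * (ε / α) by positivity)
  refine ⟨C * (α / ε), by positivity, fun a ha b hb => ?_⟩
  have hm := midpoint_mem_feasibleFlows hα ha hb
  have hia := ha.1.integrable_norm_rpow_ofReal hα0
  have hib := hb.1.integrable_norm_rpow_ofReal hα0
  have him := hm.1.integrable_norm_rpow_ofReal hα0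
  have hg : Integrable (fun x => C * ((‖a x‖ ^ α + ‖b x‖ ^ α) / 2 -
      ‖(1 / 2 : ℝ) • (a x + b x)‖ ^ α)) (volume.restrict E) :=
    (((hia.add hib).div_const 2).sub him).const_mul C
  have hs : Integrable (fun x => η * (ε / α) * (‖a x‖ ^ α + ‖b x‖ ^ α)) (volume.restrict E) :=
    (hia.add hib).const_mul _
  have h1 := integral_midpoint_gap_le (ε := ε) hE hα hw hw0 ha.1 hb.1
  have h2 := hI _ hm
  have h3 : ∫ x in E, ‖a x - b x‖ ^ α ≤ η * (ε / α) *
      ((∫ x in E, ‖a x‖ ^ α) + ∫ x in E, ‖b x‖ ^ α) +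
      C * ∫ x in E, ((‖a x‖ ^ α + ‖b x‖ ^ α) / 2 - ‖(1 / 2 : ℝ) • (a x + b x)‖ ^ α) := by
    rw [← integral_add hia hib, ← integral_const_mul, ← integral_const_mul,
      ← integral_add hs hg]
    exact integral_mono ((ha.1.sub hb.1).integrable_norm_rpow_ofReal hα0)
      (hs.add hg) fun x => hC (a x) (b x)
  set D := ∫ x in E, ((‖a x‖ ^ α + ‖b x‖ ^ α) / 2 - ‖(1 / 2 : ℝ) • (a x + b x)‖ ^ α)
  have h4 := rpow_integral_le_regObjective (α := α) (ε := ε) hE hw0 a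
  have h5 := rpow_integral_le_regObjective (α := α) (ε := ε) hE hw0 b
  have h6 : C * D ≤ C * (α / ε) *
      ((regObjective E α ε w a + regObjective E α ε w b) / 2 - I) := by
    calc C * D = C * (α / ε) * (ε / α * D) := by field_simp
      _ ≤ _ := by gcongr; linarith
  have h7 := mul_le_mul_of_nonneg_left (add_le_add h4 h5) hη.le
  linarith

/-- The solution of `(BP_ε)` is unique up to equality almost everywhere. -/
theorem SolvesBP.ae_eq (hE : IsCompact E) (hα : α.HolderConjugate α')
    (hε : 0 < ε) (hw : ContinuousOn w E) (hw0 : ∀ x ∈ E, 0 ≤ w x) {a b : Vec d → Vec d}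
    (ha : SolvesBP E α α' ε w μp μm a) (hb : SolvesBP E α α' ε w μp μm b) :
    a =ᵐ[volume.restrict E] b := by
  have hα0 := hα.pos
  have hab : regObjective E α ε w b = regObjective E α ε w a :=
    le_antisymm (hb.2 ha.1) (ha.2 hb.1)
  have ha0 : 0 ≤ regObjective E α ε w a :=
    le_trans (mul_nonneg (by positivity) (integral_nonneg fun x => by positivity))
      (rpow_integral_le_regObjective hE hw0 a)
  have hint := (ha.1.1.sub hb.1.1).integrable_norm_rpow_ofReal hα0
  have hle : ∫ x in E, ‖a x - b x‖ ^ α ≤ 0 := by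
    refine le_of_forall_pos_le_add fun η hη => ?_
    -- At two minimizers the gap term vanishes; the remaining term is at most `η` by this choice,
    -- where `+ 1` covers a zero minimum.
    obtain ⟨C, -, hC⟩ := exists_integral_norm_sub_rpow_le hE hα hε hw hw0 (fun p hp => ha.2 hp)
      (show 0 < η / (2 * regObjective E α ε w a + 1) by positivity)
    refine (hC a ha.1 b hb.1).trans ?_
    rw [hab, add_self_div_two, sub_self, mul_zero, add_zero, zero_add, div_mul_eq_mul_div,
      div_le_iff₀ (by positivity)]
    nlinarith
  have h0 := (integral_eq_zero_iff_of_nonneg (fun x => by positivity) hint).1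
    (le_antisymm hle (integral_nonneg fun x => by positivity))
  filter_upwards [h0] with x hx
  have hx' : ‖a x - b x‖ ^ α = 0 := hx
  rwa [Real.rpow_eq_zero (norm_nonneg _) hα0.ne', norm_eq_zero, sub_eq_zero] at hx'

/-- Minimizing sequences of `(BP_ε)` converge in `L^α` to a solution. -/
theorem exists_solvesBP_of_minimizing (hE : IsCompact E) (hα : α.HolderConjugate α')
    (hε : 0 < ε) (hw : ContinuousOn w E) (hw0 : ∀ x ∈ E, 0 ≤ w x) {I : ℝ}
    (hI : ∀ p ∈ feasibleFlows E α α' μp μm, I ≤ regObjective E α ε w p)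
    {q : ℕ → Vec d → Vec d} (hq : ∀ n, q n ∈ feasibleFlows E α α' μp μm)
    (hlim : Tendsto (fun n => regObjective E α ε w (q n)) atTop (𝓝 I)) :
    ∃ q₀, SolvesBP E α α' ε w μp μm q₀ ∧
      Tendsto (fun n => ∫ x in E, ‖q n x - q₀ x‖ ^ α) atTop (𝓝 0) := by
  have hα0 := hα.pos
  have hnn : ∀ p, 0 ≤ regObjective E α ε w p := fun p =>
    le_trans (mul_nonneg (by positivity) (integral_nonneg fun x => by positivity))
      (rpow_integral_le_regObjective hE hw0 p)
  have hI0 : 0 ≤ I := ge_of_tendsto' hlim fun n => hnn _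
  obtain ⟨q₀, hq₀, hq₀lim⟩ : ∃ q₀ : Vec d → Vec d,
      MemLp q₀ (ENNReal.ofReal α) (volume.restrict E) ∧
      Tendsto (fun n => ∫ x in E, ‖q n x - q₀ x‖ ^ α) atTop (𝓝 0) := by
    refine exists_memLp_tendsto_of_cauchy hα.lt.le (fun n => (hq n).1) fun η hη => ?_
    -- Once both values are below `I + 1` the first term is at most `η / 2`; once they are within `η
    -- / (4 * (C + 1))` of `I` the second is at most `η / 4`.
    obtain ⟨C, hC0, hC⟩ := exists_integral_norm_sub_rpow_le hE hα hε hw hw0 hI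
      (show 0 < η / (4 * (I + 1)) by positivity)
    have hpos : 0 < min 1 (η / (4 * (C + 1))) := by positivity
    obtain ⟨N, hN⟩ := eventually_atTop.1 (hlim.eventually_lt_const (lt_add_of_pos_right I hpos))
    refine ⟨N, fun n hn m hm => (hC _ (hq n) _ (hq m)).trans_lt ?_⟩
    have hn1 := hN n hn
    have hm1 := hN m hm
    have hl := min_le_left 1 (η / (4 * (C + 1)))
    have hr := min_le_right 1 (η / (4 * (C + 1)))
    set u := regObjective E α ε w (q n)
    set v := regObjective E α ε w (q m)
    have h1 : η / (4 * (I + 1)) * (u + v) ≤ η / (4 * (I + 1)) * (2 * (I + 1)) := by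
      gcongr; linarith
    have h2 : η / (4 * (I + 1)) * (2 * (I + 1)) = η / 2 := by field_simp; norm_num
    have h3 : C * ((u + v) / 2 - I) ≤ C * (η / (4 * (C + 1))) := by
      gcongr; linarith
    have h4 : C * (η / (4 * (C + 1))) ≤ (C + 1) * (η / (4 * (C + 1))) := by
      gcongr; linarith
    have h5 : (C + 1) * (η / (4 * (C + 1))) = η / 4 := by field_simp
    linarith
  refine ⟨q₀, ⟨mem_feasibleFlows_of_tendsto hα hq hq₀ hq₀lim, fun p hp => ?_⟩, hq₀lim⟩
  have := tendsto_nhds_unique (tendsto_regObjective hE hα hw (fun n => (hq n).1) hq₀ hq₀lim) hlim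
  exact this.trans_le (hI p hp)

end Flows

/-! ### Comparison of the two objectives as `δ → 0`. -/

section HuberComparison

variable {d : ℕ} {E : Set (Vec d)} {α α' ε : ℝ} {w : Vec d → ℝ} {μp μm : Measure (Vec d)}

/-- The doubly regularized objective is squeezed between the regularized objective and a
perturbation of it of size `δ`. -/
theorem huberObjective_bounds (hE : IsCompact E) (hα : α.HolderConjugate α')
    (hε : 0 < ε) (hw : ContinuousOn w E) (hw0 : ∀ x ∈ E, 0 ≤ w x) :
    ∃ C : ℝ, ∀ δ, 0 ≤ δ → ∀ q, MemLp q (ENNReal.ofReal α) (volume.restrict E) →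
      regObjective E α ε w q - δ * (C + ε * ∫ x in E, ‖q x‖ ^ α) ≤ huberObjective E α' ε δ w q ∧
      huberObjective E α' ε δ w q ≤ regObjective E α ε w q := by
  have hfin : IsFiniteMeasure (volume.restrict E) := isFiniteMeasure_restrict.2 hE.measure_lt_top.ne
  have hwi : Integrable w (volume.restrict E) := hw.integrableOn_compact hE
  have hci : Integrable (fun x => 3 / 2 * w x + ε) (volume.restrict E) :=
    (hwi.const_mul _).add (integrable_const _)
  refine ⟨∫ x in E, (3 / 2 * w x + ε), fun δ hδ q hq => ?_⟩
  have hiq := (hq.integrable_norm_rpow_ofReal hα.pos).const_mul ε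
  have hir := integrable_regObjective (ε := ε) hE hα hw hq
  have hil : Integrable (fun x => w x * ‖q x‖ + ε / α * ‖q x‖ ^ α -
      δ * (3 / 2 * w x + ε + ε * ‖q x‖ ^ α)) (volume.restrict E) :=
    hir.sub ((hci.add hiq).const_mul δ)
  have hid : Integrable (fun x => δ * (3 / 2 * w x + ε + ε * ‖q x‖ ^ α)) (volume.restrict E) :=
    (hci.add hiq).const_mul δ
  have hl : ∀ᵐ x ∂volume.restrict E, w x * ‖q x‖ + ε / α * ‖q x‖ ^ α -
      δ * (3 / 2 * w x + ε + ε * ‖q x‖ ^ α) ≤ calGConj α' ε δ (w x) (q x) :=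
    ae_restrict_of_forall_mem hE.measurableSet fun x hx => le_calGConj hα hε hδ (hw0 x hx) _
  have hu : ∀ᵐ x ∂volume.restrict E, calGConj α' ε δ (w x) (q x) ≤
      w x * ‖q x‖ + ε / α * ‖q x‖ ^ α :=
    ae_restrict_of_forall_mem hE.measurableSet fun x hx => calGConj_le hα hε hδ (hw0 x hx) _
  have hig : Integrable (fun x => calGConj α' ε δ (w x) (q x)) (volume.restrict E) :=
    integrable_of_le_of_le (aestronglyMeasurable_calGConj hα hε hδ hwi.aemeasurable
      (ae_restrict_of_forall_mem hE.measurableSet hw0) hq.1.aemeasurable) hl hu hil hir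
  refine ⟨?_, ?_⟩
  · rw [← integral_const_mul, ← integral_add hci hiq, ← integral_const_mul,
      regObjective_eq_integral hE hα hw hq,
      ← integral_sub hir hid]
    exact integral_mono_ae hil hig hl
  · rw [regObjective_eq_integral hE hα hw hq]
    exact integral_mono_ae hig hir hu

/-- Solutions of `(BP_{ε,δ})` are a minimizing sequence of `(BP_ε)` as `δ → 0`. -/
theorem tendsto_regObjective_of_solvesHuberBP (hE : IsCompact E) (hα : α.HolderConjugate α')
    (hε : 0 < ε) (hw : ContinuousOn w E) (hw0 : ∀ x ∈ E, 0 ≤ w x) {δ : ℕ → ℝ}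
    (hδ : ∀ n, 0 < δ n) (hδ0 : Tendsto δ atTop (𝓝 0)) {q : ℕ → Vec d → Vec d}
    (hq : ∀ n, SolvesHuberBP E α α' ε (δ n) w μp μm (q n)) :
    Tendsto (fun n => regObjective E α ε w (q n)) atTop
      (𝓝 (sInf (regObjective E α ε w '' feasibleFlows E α α' μp μm))) ∧
    ∀ p ∈ feasibleFlows E α α' μp μm,
      sInf (regObjective E α ε w '' feasibleFlows E α α' μp μm) ≤ regObjective E α ε w p := by
  have hα0 := hα.pos
  have hnn : ∀ p, 0 ≤ regObjective E α ε w p := fun p =>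
    le_trans (mul_nonneg (by positivity) (integral_nonneg fun x => by positivity))
      (rpow_integral_le_regObjective hE hw0 p)
  have hbdd : BddBelow (regObjective E α ε w '' feasibleFlows E α α' μp μm) :=
    ⟨0, by rintro _ ⟨p, -, rfl⟩; exact hnn p⟩
  have hI : ∀ p ∈ feasibleFlows E α α' μp μm,
      sInf (regObjective E α ε w '' feasibleFlows E α α' μp μm) ≤ regObjective E α ε w p :=
    fun p hp => csInf_le hbdd (mem_image_of_mem _ hp)
  refine ⟨?_, hI⟩
  obtain ⟨C, hC⟩ := huberObjective_bounds hE hα hε hw hw0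
  -- The sandwich at `q n`, its optimality, and the sandwich at a competitor `p` are chained. The
  -- error `δ ε ∫ ‖q n‖ ^ α` is at most `δ α` times the objective at `q n` and moves to the left, so
  -- no a priori bound on `q n` is needed.
  have key : ∀ n, regObjective E α ε w (q n) * (1 - δ n * α) - δ n * C ≤
      sInf (regObjective E α ε w '' feasibleFlows E α α' μp μm) := fun n => by
    refine le_csInf ⟨_, mem_image_of_mem _ (hq n).1⟩ ?_
    rintro _ ⟨p, hp, rfl⟩
    have h1 := (hC (δ n) (hδ n).le (q n) (hq n).1.1).1
    have h2 := (hC (δ n) (hδ n).le p hp.1).2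
    have h3 : huberObjective E α' ε (δ n) w (q n) ≤ huberObjective E α' ε (δ n) w p := (hq n).2 hp
    have h4 := rpow_integral_le_regObjective (α := α) (ε := ε) hE hw0 (q n)
    have h5 : ε * ∫ x in E, ‖q n x‖ ^ α ≤ α * regObjective E α ε w (q n) := by
      calc ε * ∫ x in E, ‖q n x‖ ^ α = α * (ε / α * ∫ x in E, ‖q n x‖ ^ α) := by field_simp
        _ ≤ _ := by gcongr
    have h6 := mul_le_mul_of_nonneg_left h5 (hδ n).le
    linarith
  set I := sInf (regObjective E α ε w '' feasibleFlows E α α' μp μm)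
  have hden : Tendsto (fun n => 1 - δ n * α) atTop (𝓝 1) := by
    simpa using (hδ0.mul_const α).const_sub 1
  have hup : Tendsto (fun n => (I + δ n * C) / (1 - δ n * α)) atTop (𝓝 I) := by
    simpa [Pi.div_def] using ((hδ0.mul_const C).const_add I).div hden one_ne_zero
  refine tendsto_of_tendsto_of_tendsto_of_le_of_le' tendsto_const_nhds hup
    (Eventually.of_forall fun n => hI _ (hq n).1) ?_
  -- Division by `1 - δ n * α` is legitimate only once `δ n` is small.
  filter_upwards [hden.eventually_const_lt zero_lt_one] with n hn
  rw [le_div_iff₀ hn]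
  linarith [key n]

end HuberComparison

/-! ### The convergence theorem. -/

theorem mainTheorem8 {d : ℕ} (hd : 1 ≤ d)
    -- the compact domain
    (Ω : Set (Vec d)) (hΩ : IsCompact Ω) (hLip : IsBoundedLipschitzDomain (interior Ω))
    (hstar : IsStrictlyStarShaped Ω)
    -- the exponents: `1 < α < d / (d - 1)` and `α'` conjugate to `α`
    (α α' : ℝ) (hα : α.HolderConjugate α') (hαd : α * ((d : ℝ) - 1) < d)
    -- the marginals, probability measures on `Ω`
    (μp μm : Measure (Vec d)) [IsProbabilityMeasure μp] [IsProbabilityMeasure μm]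
    (hμp : μp Ωᶜ = 0) (hμm : μm Ωᶜ = 0)
    -- the dilated domain `E = (1 + s) Ω`
    (s : ℝ) (hs : 0 ≤ s) (E : Set (Vec d)) (hE : E = (1 + s) • Ω)
    -- the cost `w` on `Ω` and its continuous extension `w'` to `E` with the same minimum
    (w : Vec d → ℝ) (hw : ContinuousOn w Ω) (hw0 : ∀ x ∈ Ω, 0 ≤ w x)
    (w' : Vec d → ℝ) (hw' : ContinuousOn w' E) (hww' : ∀ x ∈ Ω, w' x = w x)
    (m : ℝ) (hm : IsLeast (w '' Ω) m) (hm' : IsLeast (w' '' E) m)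
    -- the regularization parameters
    (ε : ℝ) (hε : 0 < ε) (δ : ℕ → ℝ) (hδ : ∀ n, 0 < δ n) (hδ0 : Tendsto δ atTop (𝓝 0))
    -- solutions of the doubly regularized problems
    (q : ℕ → Vec d → Vec d) (hq : ∀ n, SolvesHuberBP E α α' ε (δ n) w' μp μm (q n)) :
    ∃ (k : ℕ → ℕ) (q₀ : Vec d → Vec d), StrictMono k ∧
      WeakStarTendsto E (fun n => q (k n)) q₀ ∧
      SolvesBP E α α' ε w' μp μm q₀ ∧
      ∀ p, SolvesBP E α α' ε w' μp μm p → p =ᵐ[volume.restrict E] q₀ := by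

  have hEc : IsCompact E := hE ▸ hΩ.smul _
  -- The extension shares its minimum with `w`, hence is nonnegative on `E`.
  have hw0' : ∀ x ∈ E, 0 ≤ w' x := fun x hx => by
    obtain ⟨y, hy, hym⟩ := hm.1
    exact (hw0 y hy).trans (hym.trans_le (hm'.2 (mem_image_of_mem w' hx)))
  obtain ⟨hlim, hI⟩ := tendsto_regObjective_of_solvesHuberBP hEc hα hε hw' hw0' hδ hδ0 hq
  obtain ⟨q₀, hq₀, hconv⟩ :=
    exists_solvesBP_of_minimizing hEc hα hε hw' hw0' hI (fun n => (hq n).1) hlim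
  -- The whole sequence converges, so the identity is the subsequence.
  refine ⟨id, q₀, strictMono_id, fun ψ hψ => ?_, hq₀,
    fun p hp => SolvesBP.ae_eq hEc hα hε hw' hw0' hp hq₀⟩
  have := tendsto_integral_inner hα (fun n => (hq n).1.1) hq₀.1.1
    (memLp_of_continuousOn hEc hψ _) hconv
  simpa only [id, real_inner_comm] using this
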